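/- Let $K$ be either a number field, or an algebraic function field in one variable with exact field of constants $k$ (an arbitrary field) together with a fixed element $x\in K$ transcendental over $k$ (so $[K:k(x)]<\infty$). In the number field case let $\mathcal{O}_K$ be the ring of integers, let $S$ be the set of archimedean places, let $k$ be the set consisting of $0$ and the roots of unity of $K$, put $q=e$, and for $\mathfrak{p}\in S$ with embedding $\sigma:K\to\mathbb{C}$ put $\deg\mathfrak{p}=1$ if $\sigma(K)\subseteq\mathbb{R}$, $\deg\mathfrak{p}=2$ otherwise, and $\nu_\mathfrak{p}(f)=-\log|\sigma(f)|$ for $f\in K^*$. In the function field case let $\mathcal{O}_K$ be the integral closure of $k[x]$ in $K$, let $S$ be the set of places of $K/k$ lying over the infinite place of $k(x)$, let $q>1$ be a real number, and for $\mathfrak{p}\in S$ let $\nu_\mathfrak{p}$ be the normalized discrete valuation and $\deg\mathfrak{p}$ the dimension over $k$ of the residue field. In both cases put $|f|_\mathfrak{p}=q^{-\nu_\mathfrak{p}(f)\deg\mathfrak{p}}$ for $f\in K^*$ and $|0|_\mathfrak{p}=0$. "Ideal" means nonzero fractional ideal of $\mathcal{O}_K$. For an ideal $\mathfrak{a}$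 and $t=(t_\mathfrak{p})_{\mathfrak{p}\in S}$, with $t_\mathfrak{p}$ in $\mathbb{R}$ (number field) or $\mathbb{Z}$ (function field), let \[ B(\mathfrak{a},t)=\{h\in\mathfrak{a} : |h|_\mathfrak{p}\le q^{t_\mathfrak{p}\deg\mathfrak{p}} \text{ for all } \mathfrak{p}\in S\}. \] For $\mu\in K^*$ put $B(\mathfrak{a},\mu)=B(\mathfrak{a},(-\nu_\mathfrak{p}(\mu))_{\mathfrak{p}\in S})$. An element $\mu\in\mathfrak{a}\setminus\{0\}$ is a minimum of $\mathfrak{a}$ if every $h\in B(\mathfrak{a},\mu)$ satisfies $h=0$ or $|h|_\mathfrak{p}=|\mu|_\mathfrak{p}$ for all $\mathfrak{p}\in S$; the ideal $\mathfrak{a}$ is reduced if $1\in\mathfrak{a}$ and $1$ is a minimum of $\mathfrak{a}$. For ideals $\mathfrak{b},\mathfrak{b}'$ write $\mathfrak{b}\sim\mathfrak{b}'$ if there is $h\in K^*$ with $\mathfrak{b}=h\mathfrak{b}'$ and $|h|_\mathfrak{p}=1$ for all $\mathfrak{p}\in S$. Assume that $\deg\mathfrak{p}=1$ for some $\mathfrak{p}\in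 S$. Then: 1. every reduced ideal $\mathfrak{b}$ satisfies $B(\mathfrak{b},(0,\dots,0))=k$; 2. for any two reduced ideals $\mathfrak{b},\mathfrak{b}'$, one has $\mathfrak{b}\sim\mathfrak{b}'$ if and only if $\mathfrak{b}=\mathfrak{b}'$. -/

import Mathlib

open scoped nonZeroDivisors Polynomial WithZero RatFunc

universe u v

namespace Infrastructure

/-! ### Boxes, minima, reduced ideals, equivalence

These notions have the same definition for number fields and for function fields; they only use
the infinite places, their valuations and degrees, and the base `q` of the absolute values.
`InfiniteData K` collects this; only the two concrete instances `numberFieldData` and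
`functionFieldData` built below are used. -/

/-- The set `S` of infinite places, their valuations `ν` (only meaningful on nonzero elements),
their degrees, and the base `q` of the absolute values. -/
structure InfiniteData (K : Type u) where
  /-- the set of infinite places -/
  S : Type u
  /-- the valuation of a place -/
  ν : S → K → ℝ
  /-- the degree of a place -/
  deg : S → ℕ
  /-- the base of the absolute values -/
  q : ℝ

namespace InfiniteData

variable {K : Type u} [Field K] (D : InfiniteData K)

open scoped Classical in
/-- `|h|_𝔭 = q ^ (-ν_𝔭(h) deg 𝔭)` for `h ≠ 0`, and `|0|_𝔭 = 0`. -/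
noncomputable def absVal (p : D.S) (h : K) : ℝ :=
  if h = 0 then 0 else D.q ^ (-(D.ν p h) * (D.deg p : ℝ))

section

variable {O : Type v} [CommRing O] [Algebra O K] [IsFractionRing O K]

/-- The box `B(𝔞, t)`: all `h ∈ 𝔞` with `|h|_𝔭 ≤ q ^ (t_𝔭 deg 𝔭)` for all infinite places `𝔭`. -/
def box (a : FractionalIdeal O⁰ K) (t : D.S → ℝ) : Set K :=
  {h : K | h ∈ a ∧ ∀ p : D.S, D.absVal p h ≤ D.q ^ (t p * (D.deg p : ℝ))}

/-- The box `B(𝔞, μ) = B(𝔞, (-ν_𝔭(μ))_𝔭)` attached to an element `μ ∈ K^*`. -/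
def boxOf (a : FractionalIdeal O⁰ K) (μ : K) : Set K :=
  D.box a (fun p => -(D.ν p μ))

/-- `μ` is a minimum of `𝔞`: it is a nonzero element of `𝔞`, and every `h ∈ B(𝔞, μ)` is `0` or has
the same absolute values as `μ` at all infinite places. -/
def IsMinimum (a : FractionalIdeal O⁰ K) (μ : K) : Prop :=
  μ ∈ a ∧ μ ≠ 0 ∧ ∀ h ∈ D.boxOf a μ, h = 0 ∨ ∀ p : D.S, D.absVal p h = D.absVal p μ

/-- `𝔞` is reduced: `1 ∈ 𝔞` is a minimum of `𝔞` (in particular `𝔞 ≠ 0`). -/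
def IsReduced (a : FractionalIdeal O⁰ K) : Prop :=
  D.IsMinimum a 1

/-- `𝔟 ∼ 𝔟'`: there is `h ∈ K^*` with `𝔟 = h 𝔟'` and `|h|_𝔭 = 1` at all infinite places `𝔭`. -/
def Equivalent (b b' : FractionalIdeal O⁰ K) : Prop :=
  ∃ h : K, h ≠ 0 ∧ b = FractionalIdeal.spanSingleton O⁰ h * b' ∧ ∀ p : D.S, D.absVal p h = 1

end

end InfiniteData

/-! ### Number fields -/

section NumberField

variable (K : Type u) [Field K]

/-- The infinite places of a number field are its archimedean places, with
`ν_𝔭(f) = -log |σ(f)|`, `deg 𝔭 = 1` for real and `2` for complex places, and `q = e`. -/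
noncomputable def numberFieldData : InfiniteData K where
  S := NumberField.InfinitePlace K
  ν w f := -Real.log (w f)
  deg w := w.mult
  q := Real.exp 1

/-- `k = k^* ∪ {0}`, where `k^*` is the set of roots of unity of `K`. -/
def numberFieldConstants : Set K :=
  {h : K | h = 0 ∨ ∃ n : ℕ, 0 < n ∧ h ^ n = 1}

end NumberField

/-! ### Function fields -/

section FunctionField

variable (k : Type v) (K : Type u) [Field k] [Field K] [Algebra k K]

/-- A place of `K / k`, given by its valuation ring: a discrete valuation ring with field of
fractions `K` that contains `k`. -/
structure Place where
  /-- the valuation ring of the place -/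
  valRing : ValuationSubring K
  algebraMap_mem : ∀ c : k, algebraMap k K c ∈ valRing
  isDVR : IsDiscreteValuationRing valRing

namespace Place

variable {k K} (P : Place k K)

/-- The normalized discrete valuation of the place, written additively (`0` at the zero element).
Mathlib's normalized valuation of the maximal ideal is multiplicative, hence the sign. -/
noncomputable def ord (f : K) : ℤ :=
  haveI : IsDiscreteValuationRing P.valRing := P.isDVR
  let v : Valuation K ℤᵐ⁰ := (IsDiscreteValuationRing.maximalIdeal P.valRing).valuation K
  (-WithZero.log (v f) : ℤ)

/-- The embedding of the constants into the residue field of the place. -/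
noncomputable def residueMap : k →+* IsLocalRing.ResidueField P.valRing :=
  (IsLocalRing.residue P.valRing).comp
    ((algebraMap k K).codRestrict P.valRing.toSubring P.algebraMap_mem)

/-- The degree of the place: the dimension over `k` of the residue field. -/
noncomputable def degree : ℕ :=
  letI := P.residueMap.toAlgebra
  Module.finrank k (IsLocalRing.ResidueField P.valRing)

open scoped Classical in
/-- The place lies over the infinite place of `k(x)`. -/
def IsInfinite [Algebra k⟮X⟯ K] : Prop :=
  P.valRing.comap (algebraMap k⟮X⟯ K) = (RatFunc.inftyValuation k).valuationSubring

end Place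

/-- The infinite places of a function field are those lying over the infinite place of `k(x)`;
`q > 1` is the base of the absolute values. -/
noncomputable def functionFieldData [Algebra k⟮X⟯ K] (q : ℝ) : InfiniteData K where
  S := {P : Place k K // P.IsInfinite}
  ν P f := (P.1.ord f : ℝ)
  deg P := P.1.degree
  q := q

end FunctionField

end Infrastructure

namespace Infrastructure

/-! ### Absolute values and the unit box of a reduced ideal -/

namespace InfiniteData

variable {K : Type u} [Field K] (D : InfiniteData K)

/-! Since 1 is a minimum of a reduced ideal, nonzero elements of its unit box have absolute value 1
at every infinite place. One place of degree one then forces them to be constants. At a real place,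
absolute value 1 leaves only 1 and -1. At a degree-one place of a function field, an element `h` of
the box is congruent to a constant `c`; `h - c` is still in the box but is smaller than 1 at that
place, so `h = c`.

For the second claim, if `b = h b'` then `1 ∈ b'` gives `h ∈ b`, so `h` lies in the unit box and is
a nonzero constant. It is therefore a unit of the ring of integers, and `h b' = b'`
(`IsReduced.equivalent_iff`). -/

theorem absVal_of_ne_zero (p : D.S) {h : K} (hh : h ≠ 0) :
    D.absVal p h = D.q ^ (-(D.ν p h) * (D.deg p : ℝ)) := if_neg hh

theorem absVal_zero (p : D.S) : D.absVal p 0 = 0 := if_pos rfl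

variable {D}

theorem absVal_le_one_iff (hq : 1 < D.q) (p : D.S) {h : K} (hh : h ≠ 0) :
    D.absVal p h ≤ 1 ↔ 0 ≤ D.ν p h * (D.deg p : ℝ) := by
  rw [D.absVal_of_ne_zero p hh, neg_mul, ← Real.rpow_zero D.q,
    Real.rpow_le_rpow_left_iff hq, neg_nonpos]

theorem absVal_eq_one_iff (hq : 1 < D.q) (p : D.S) {h : K} (hh : h ≠ 0) :
    D.absVal p h = 1 ↔ D.ν p h * (D.deg p : ℝ) = 0 := by
  rw [D.absVal_of_ne_zero p hh, neg_mul, ← Real.rpow_zero D.q,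
    (Real.strictMono_rpow_of_base_gt_one hq).injective.eq_iff, neg_eq_zero]

theorem absVal_one (hν : ∀ p, D.ν p 1 = 0) (p : D.S) : D.absVal p 1 = 1 := by
  rw [D.absVal_of_ne_zero p one_ne_zero, hν p, neg_zero, zero_mul, Real.rpow_zero]

section

variable {O : Type v} [CommRing O] [Algebra O K]

theorem mem_box_zero {a : FractionalIdeal O⁰ K} {h : K} :
    h ∈ D.box a (fun _ => 0) ↔ h ∈ a ∧ ∀ p, D.absVal p h ≤ 1 := by
  simp [box]

/-- In a reduced ideal, the nonzero elements of the unit box have absolute value one at all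
infinite places. -/
theorem IsReduced.eq_zero_or_absVal_eq_one {b : FractionalIdeal O⁰ K} (hb : D.IsReduced b)
    (hν : ∀ p, D.ν p 1 = 0) {h : K} (hh : h ∈ b) (hle : ∀ p, D.absVal p h ≤ 1) :
    h = 0 ∨ ∀ p, D.absVal p h = 1 := by
  have hmem : h ∈ D.boxOf b 1 := by
    simpa [boxOf, box, hν] using And.intro hh hle
  simpa only [absVal_one hν] using hb.2.2 h hmem

variable [IsFractionRing O K]

theorem Equivalent.refl (hν : ∀ p, D.ν p 1 = 0) (b : FractionalIdeal O⁰ K) :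
    D.Equivalent b b :=
  ⟨1, one_ne_zero, by simp, absVal_one hν⟩

/-- Reduced ideals are equivalent only if they are equal, provided that every nonzero element of
the unit box of a reduced ideal comes from a unit of `O`. -/
theorem IsReduced.equivalent_iff (hν : ∀ p, D.ν p 1 = 0) {b b' : FractionalIdeal O⁰ K}
    (hb' : D.IsReduced b')
    (hunit : ∀ h ∈ D.box b (fun _ => 0), h ≠ 0 → ∃ u : Oˣ, algebraMap O K u = h) :
    D.Equivalent b b' ↔ b = b' := by
  refine ⟨?_, fun h => h ▸ Equivalent.refl hν b⟩
  rintro ⟨h, h0, hbb', habs⟩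
  have hmem : h ∈ b := by
    rw [hbb', FractionalIdeal.mem_singleton_mul]
    exact ⟨1, hb'.1, (mul_one h).symm⟩
  obtain ⟨u, rfl⟩ := hunit h (mem_box_zero.2 ⟨hmem, fun p => (habs p).le⟩) h0
  rw [hbb']
  ext y
  rw [FractionalIdeal.mem_singleton_mul]
  constructor
  · rintro ⟨z, hz, rfl⟩
    rw [← Algebra.smul_def]
    exact Submodule.smul_mem (b' : Submodule O K) _ hz
  · intro hy
    refine ⟨((u⁻¹ : Oˣ) : O) • y, Submodule.smul_mem (b' : Submodule O K) _ hy, ?_⟩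
    rw [← Algebra.smul_def, smul_smul, Units.mul_inv, one_smul]

end

end InfiniteData

/-! ### Number fields -/

section NumberField

variable (K : Type u) [Field K]

theorem one_lt_q_numberFieldData : 1 < (numberFieldData K).q :=
  Real.one_lt_exp_iff.2 one_pos

theorem numberFieldData_ν_one (p : (numberFieldData K).S) : (numberFieldData K).ν p 1 = 0 := by
  let w : NumberField.InfinitePlace K := p
  change -Real.log (w 1) = 0
  simp

variable {K}

theorem isReal_of_deg_eq_one {w : NumberField.InfinitePlace K}
    (hw : (numberFieldData K).deg w = 1) : w.IsReal := by
  by_contra h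
  rw [NumberField.InfinitePlace.not_isReal_iff_isComplex] at h
  have h2 : (numberFieldData K).deg w = 2 := NumberField.InfinitePlace.mult_isComplex ⟨w, h⟩
  lia

/-- The real embedding is injective, and 1 and -1 are the only reals of absolute value 1. -/
theorem eq_one_or_eq_neg_one_of_isReal {w : NumberField.InfinitePlace K} (hw : w.IsReal) {h : K}
    (hh : w h = 1) : h = 1 ∨ h = -1 := by
  let σ := NumberField.InfinitePlace.embedding_of_isReal hw
  have hn : ‖σ h‖ = 1 := by
    rw [NumberField.InfinitePlace.norm_embedding_of_isReal, hh]
  rw [Real.norm_eq_abs, abs_eq zero_le_one] at hn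
  exact hn.imp (fun e => σ.injective (by simpa using e))
    (fun e => σ.injective (by simpa using e))

theorem eq_one_or_eq_neg_one_of_absVal_eq_one {p : (numberFieldData K).S}
    (hp : (numberFieldData K).deg p = 1) {h : K} (hh : h ≠ 0)
    (habs : (numberFieldData K).absVal p h = 1) : h = 1 ∨ h = -1 := by
  let w : NumberField.InfinitePlace K := p
  have hw : w.IsReal := isReal_of_deg_eq_one hp
  rw [InfiniteData.absVal_eq_one_iff (one_lt_q_numberFieldData K) p hh, hp, Nat.cast_one,
    mul_one] at habs
  have hlog : Real.log (w h) = 0 := neg_eq_zero.1 habs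
  have hpos : 0 < w h := NumberField.InfinitePlace.pos_iff.2 hh
  exact eq_one_or_eq_neg_one_of_isReal hw (Real.eq_one_of_pos_of_log_eq_zero hpos hlog)

theorem eq_one_or_eq_neg_one_of_pow_eq_one {w : NumberField.InfinitePlace K} (hw : w.IsReal)
    {h : K} {n : ℕ} (hn : 0 < n) (hh : h ^ n = 1) : h = 1 ∨ h = -1 := by
  refine eq_one_or_eq_neg_one_of_isReal hw ?_
  refine (pow_eq_one_iff_of_nonneg (apply_nonneg w h) hn.ne').1 ?_
  rw [← map_pow, hh, map_one]

theorem box_eq_numberFieldConstants [NumberField K] {p : (numberFieldData K).S}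
    (hp : (numberFieldData K).deg p = 1)
    {b : FractionalIdeal (NumberField.RingOfIntegers K)⁰ K} (hb : (numberFieldData K).IsReduced b) :
    (numberFieldData K).box b (fun _ => 0) = numberFieldConstants K := by
  ext h
  rw [InfiniteData.mem_box_zero]
  constructor
  · rintro ⟨hh, hle⟩
    rcases eq_or_ne h 0 with h0 | h0
    · exact Or.inl h0
    have habs := (hb.eq_zero_or_absVal_eq_one (numberFieldData_ν_one K) hh hle).resolve_left h0
    refine Or.inr ⟨2, two_pos, ?_⟩
    rcases eq_one_or_eq_neg_one_of_absVal_eq_one hp h0 (habs p) with rfl | rfl <;> simp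
  · rintro (rfl | ⟨n, hn, hpow⟩)
    · exact ⟨FractionalIdeal.zero_mem b, fun p => by simp [InfiniteData.absVal_zero]⟩
    · have hone : ∀ r : (numberFieldData K).S, (numberFieldData K).absVal r 1 = 1 :=
        InfiniteData.absVal_one (numberFieldData_ν_one K)
      rcases eq_one_or_eq_neg_one_of_pow_eq_one
        (isReal_of_deg_eq_one hp) hn hpow with rfl | rfl
      · exact ⟨hb.1, fun r => (hone r).le⟩
      · refine ⟨b.coeToSubmodule.neg_mem hb.1, fun r => ?_⟩
        have hneg : (numberFieldData K).ν r (-1) = 0 := by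
          let w : NumberField.InfinitePlace K := r
          change -Real.log (w.1 (-1)) = 0
          simp
        rw [InfiniteData.absVal_le_one_iff (one_lt_q_numberFieldData K) r (by simp), hneg, zero_mul]

theorem numberField_equivalent_iff [NumberField K] {p : (numberFieldData K).S}
    (hp : (numberFieldData K).deg p = 1)
    {b b' : FractionalIdeal (NumberField.RingOfIntegers K)⁰ K}
    (hb : (numberFieldData K).IsReduced b) (hb' : (numberFieldData K).IsReduced b') :
    (numberFieldData K).Equivalent b b' ↔ b = b' := by
  refine hb'.equivalent_iff (numberFieldData_ν_one K) fun h hh h0 => ?_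
  obtain ⟨hmem, hle⟩ := InfiniteData.mem_box_zero.1 hh
  have habs := (hb.eq_zero_or_absVal_eq_one (numberFieldData_ν_one K) hmem hle).resolve_left h0
  rcases eq_one_or_eq_neg_one_of_absVal_eq_one hp h0 (habs p) with rfl | rfl
  · exact ⟨1, by simp⟩
  · exact ⟨-1, by simp⟩

end NumberField

/-! ### Function fields -/

section FunctionField

variable {k : Type v} {K : Type u} [Field k] [Field K] [Algebra k K]

namespace Place

variable (P : Place k K)

theorem ord_one : P.ord 1 = 0 := by
  simp [ord]

theorem ord_nonneg_iff {f : K} (hf : f ≠ 0) : 0 ≤ P.ord f ↔ f ∈ P.valRing := by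
  have : IsDiscreteValuationRing P.valRing := P.isDVR
  let v : Valuation K ℤᵐ⁰ := (IsDiscreteValuationRing.maximalIdeal P.valRing).valuation K
  have hv : v f ≠ 0 := v.ne_zero_iff.2 hf
  have key : 0 ≤ P.ord f ↔ v f ≤ 1 := by
    change 0 ≤ -WithZero.log (v f) ↔ _
    rw [neg_nonneg, WithZero.log_le_iff_le_exp hv, WithZero.exp_zero]
  rw [key]
  constructor
  · intro h
    obtain ⟨a, rfl⟩ := IsDiscreteValuationRing.exists_lift_of_le_one h
    exact a.2
  · intro h
    exact (IsDiscreteValuationRing.maximalIdeal P.valRing).valuation_le_one ⟨f, h⟩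

/-- Zero must be excluded, because `ord` takes the default value 0 there. -/
theorem ord_pos_of_mem_maximalIdeal {f : P.valRing} (hf : (f : K) ≠ 0)
    (hm : f ∈ IsLocalRing.maximalIdeal P.valRing) : 0 < P.ord f := by
  have : IsDiscreteValuationRing P.valRing := P.isDVR
  let v : Valuation K ℤᵐ⁰ := (IsDiscreteValuationRing.maximalIdeal P.valRing).valuation K
  have hv : v f ≠ 0 := v.ne_zero_iff.2 hf
  change 0 < -WithZero.log (v f)
  rw [neg_pos, WithZero.log_lt_iff_lt_exp hv, WithZero.exp_zero]
  exact ((IsDiscreteValuationRing.maximalIdeal P.valRing).valuation_lt_one_iff_mem f).2 hm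

/-- At a place of degree one, every integral element is congruent to a constant. -/
theorem exists_sub_algebraMap_mem_maximalIdeal (hP : P.degree = 1) (f : P.valRing) :
    ∃ c : k, f - ⟨algebraMap k K c, P.algebraMap_mem c⟩ ∈ IsLocalRing.maximalIdeal P.valRing := by
  let _ := P.residueMap.toAlgebra
  have hfin : Module.finrank k (IsLocalRing.ResidueField P.valRing) = 1 := hP
  -- The residue field is a line over `k`, spanned by 1.
  obtain ⟨c, hc⟩ := (finrank_eq_one_iff_of_nonzero' (1 : IsLocalRing.ResidueField P.valRing)
    one_ne_zero).1 hfin (IsLocalRing.residue P.valRing f)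
  refine ⟨c, ?_⟩
  rw [← IsLocalRing.residue_eq_zero_iff, map_sub, sub_eq_zero, ← hc, Algebra.smul_def, mul_one]
  rfl

end Place

section

variable [Algebra k⟮X⟯ K] {q : ℝ}

theorem functionFieldData_ν_one (p : (functionFieldData k K q).S) :
    (functionFieldData k K q).ν p 1 = 0 := by
  change ((p.1.ord 1 : ℤ) : ℝ) = 0
  rw [p.1.ord_one, Int.cast_zero]

/-- Degree 0 is the default of `finrank` for an infinite-dimensional residue field; carrying it as a
separate case spares a proof that all degrees are finite. -/
theorem functionFieldData_absVal_le_one_iff (hq : 1 < q) (p : (functionFieldData k K q).S)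
    (h : K) : (functionFieldData k K q).absVal p h ≤ 1 ↔
      p.1.degree = 0 ∨ h ∈ p.1.valRing := by
  rcases eq_or_ne h 0 with rfl | h0
  · simp [InfiniteData.absVal_zero, p.1.valRing.zero_mem]
  rw [InfiniteData.absVal_le_one_iff hq p h0, ← p.1.ord_nonneg_iff h0]
  change 0 ≤ ((p.1.ord h : ℤ) : ℝ) * (p.1.degree : ℝ) ↔ _
  rcases Nat.eq_zero_or_pos p.1.degree with hd | hd
  · simp [hd]
  · rw [mul_nonneg_iff_of_pos_right (Nat.cast_pos.2 hd), Int.cast_nonneg_iff]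
    simp [hd.ne']

end

variable [Algebra k[X] K] [IsScalarTower k k[X] K]

theorem functionField_algebraMap_mem {b : FractionalIdeal (FunctionField.ringOfIntegers k K)⁰ K}
    (hb : (1 : K) ∈ b) (c : k) : algebraMap k K c ∈ b := by
  have hc : algebraMap k K c = algebraMap (FunctionField.ringOfIntegers k K) K
      (algebraMap k[X] _ (Polynomial.C c)) := by
    rw [← IsScalarTower.algebraMap_apply, IsScalarTower.algebraMap_apply k k[X] K,
      Polynomial.algebraMap_eq]
  rw [hc, ← mul_one (algebraMap _ K _), ← Algebra.smul_def]
  exact (b : Submodule (FunctionField.ringOfIntegers k K) K).smul_mem _ hb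

variable [Algebra k⟮X⟯ K] {q : ℝ}

theorem box_eq_range_algebraMap (hq : 1 < q) {p : (functionFieldData k K q).S}
    (hp : (functionFieldData k K q).deg p = 1)
    {b : FractionalIdeal (FunctionField.ringOfIntegers k K)⁰ K}
    (hb : (functionFieldData k K q).IsReduced b) :
    (functionFieldData k K q).box b (fun _ => 0) = Set.range (algebraMap k K) := by
  have hdeg : p.1.degree = 1 := hp
  ext h
  rw [InfiniteData.mem_box_zero]
  constructor
  · rintro ⟨hh, hle⟩
    have hint : h ∈ p.1.valRing :=
      ((functionFieldData_absVal_le_one_iff hq p h).1 (hle p)).resolve_left (by simp [hdeg])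
    obtain ⟨c, hc⟩ := p.1.exists_sub_algebraMap_mem_maximalIdeal hdeg ⟨h, hint⟩
    refine ⟨c, ?_⟩
    by_contra hne
    have h0 : h - algebraMap k K c ≠ 0 := sub_ne_zero.2 (Ne.symm hne)
    -- Valuation rings contain `k` and are closed under subtraction, so `h - c` stays in the unit
    -- box.
    have habs := (hb.eq_zero_or_absVal_eq_one functionFieldData_ν_one
      (b.coeToSubmodule.sub_mem hh
        (functionField_algebraMap_mem hb.1 c))
      fun r => (functionFieldData_absVal_le_one_iff hq r _).2
        (((functionFieldData_absVal_le_one_iff hq r h).1 (hle r)).imp_right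
          fun hr => sub_mem hr (r.1.algebraMap_mem c))).resolve_left h0 p
    rw [InfiniteData.absVal_eq_one_iff hq p h0, hp, Nat.cast_one, mul_one] at habs
    have hzero : p.1.ord (h - algebraMap k K c) = 0 := Int.cast_eq_zero.1 habs
    exact (p.1.ord_pos_of_mem_maximalIdeal h0 hc).ne' hzero
  · rintro ⟨c, rfl⟩
    exact ⟨functionField_algebraMap_mem hb.1 c, fun r =>
      (functionFieldData_absVal_le_one_iff hq r _).2 (Or.inr (r.1.algebraMap_mem c))⟩

variable [IsScalarTower k[X] k⟮X⟯ K] [FunctionField k K]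

theorem functionField_equivalent_iff (hq : 1 < q) {p : (functionFieldData k K q).S}
    (hp : (functionFieldData k K q).deg p = 1)
    {b b' : FractionalIdeal (FunctionField.ringOfIntegers k K)⁰ K}
    (hb : (functionFieldData k K q).IsReduced b) (hb' : (functionFieldData k K q).IsReduced b') :
    (functionFieldData k K q).Equivalent b b' ↔ b = b' := by
  refine hb'.equivalent_iff functionFieldData_ν_one fun h hh h0 => ?_
  rw [box_eq_range_algebraMap hq hp hb] at hh
  obtain ⟨c, rfl⟩ := hh
  have hc : IsUnit c := isUnit_iff_ne_zero.2 ((map_ne_zero _).1 h0)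
  -- The unit is `c` seen as a constant polynomial.
  refine ⟨Units.map ((algebraMap k[X] (FunctionField.ringOfIntegers k K)).comp
    Polynomial.C : k →* _) hc.unit, ?_⟩
  change algebraMap (FunctionField.ringOfIntegers k K) K (algebraMap k[X] _ (Polynomial.C c)) = _
  rw [← IsScalarTower.algebraMap_apply, IsScalarTower.algebraMap_apply k k[X] K,
    Polynomial.algebraMap_eq]

end FunctionField

end Infrastructure

theorem proposition5p1 :
    -- number fields
    (∀ (K : Type u) [Field K] [NumberField K],
      (∃ p : (Infrastructure.numberFieldData K).S, (Infrastructure.numberFieldData K).deg p = 1) →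
      (∀ b : FractionalIdeal (NumberField.RingOfIntegers K)⁰ K,
        (Infrastructure.numberFieldData K).IsReduced b →
          (Infrastructure.numberFieldData K).box b (fun _ => 0) =
            Infrastructure.numberFieldConstants K) ∧
      (∀ b b' : FractionalIdeal (NumberField.RingOfIntegers K)⁰ K,
        (Infrastructure.numberFieldData K).IsReduced b →
        (Infrastructure.numberFieldData K).IsReduced b' →
          ((Infrastructure.numberFieldData K).Equivalent b b' ↔ b = b'))) ∧
    -- function fields with exact field of constants `k`, of finite degree over `k(x)`
    (∀ (k : Type v) (K : Type u) [Field k] [Field K] [Algebra k K] [Algebra k[X] K]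
      [Algebra k⟮X⟯ K] [IsScalarTower k k[X] K] [IsScalarTower k[X] k⟮X⟯ K] [FunctionField k K],
      (∀ y : K, IsAlgebraic k y → y ∈ Set.range (algebraMap k K)) →
      ∀ q : ℝ, 1 < q →
      (∃ p : (Infrastructure.functionFieldData k K q).S,
        (Infrastructure.functionFieldData k K q).deg p = 1) →
      (∀ b : FractionalIdeal (FunctionField.ringOfIntegers k K)⁰ K,
        (Infrastructure.functionFieldData k K q).IsReduced b →
          (Infrastructure.functionFieldData k K q).box b (fun _ => 0) =
            Set.range (algebraMap k K)) ∧
      (∀ b b' : FractionalIdeal (FunctionField.ringOfIntegers k K)⁰ K,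
        (Infrastructure.functionFieldData k K q).IsReduced b →
        (Infrastructure.functionFieldData k K q).IsReduced b' →
          ((Infrastructure.functionFieldData k K q).Equivalent b b' ↔ b = b'))) := by
  refine ⟨fun K _ _ ⟨_, hp⟩ => ?_, fun k K _ _ _ _ _ _ _ _ _ q hq ⟨_, hp⟩ => ?_⟩
  · exact ⟨fun b hb => Infrastructure.box_eq_numberFieldConstants hp hb,
      fun b b' hb hb' => Infrastructure.numberField_equivalent_iff hp hb hb'⟩
  · exact ⟨fun b hb => Infrastructure.box_eq_range_algebraMap hq hp hb,
      fun b b' hb hb' => Infrastructure.functionField_equivalent_iff hq hp hb hb'⟩
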